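/- Conventions. A closed contour is a closed curve $\Gamma\subset\mathbb C$ that is continuous and, off finitely many parameter values, continuously differentiable with bounded derivative (in particular, any closed piecewise $C^1$ curve). $\Gamma$ encircles a point $a$ if $a\notin\Gamma$ and $\Gamma$ has winding number $1$ about $a$. $\Gamma_{\rm out}$ encloses $\Gamma_{\rm in}$ if $\Gamma_{\rm out}$ encircles every point that lies on $\Gamma_{\rm in}$ or about which $\Gamma_{\rm in}$ has non-zero winding number. A kernel $K:\mathbb C\times\mathbb C\to\mathbb C$ is integrable in the sense of Its, Izergin, Korepin and Slavnov (IIKS) if there are an integer $L\ge 0$ and functions $F_1,\dots,F_L,G_1,\dots,G_L$ on $\mathbb C$ with $$K(x,y)=\sum_{l=1}^{L}\frac{F_l(x)G_l(y)}{x-y}\quad(x\neq y),\qquad \sum_{l=1}^{L}F_l(x)G_l(x)=0\quad\text{for all }x.$$ Let $n,m\ge 0$ and $\nu$ be integers, and let $\hat\pi_1,\dots,\hat\pi_n,\hat\theta_1,\dots,\hat\theta_m\in\mathbb C$. Let $\Gamma_{\rm in}$ be a closed contour encircling $0,\hat\theta_1,\dots,\hat\theta_m$, and let $\Gamma_{\rm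 out}$ be a closed contour that encircles $\hat\pi_1,\dots,\hat\pi_n$ and encloses $\Gamma_{\rm in}$. The Bessel kernel with finite rank perturbations is $$\mathbb K^{(n,m)}_{\rm III}(x,y)=\oint_{\Gamma_{\rm out}}\frac{dv}{2\pi i}\oint_{\Gamma_{\rm in}}\frac{du}{2\pi i}\,\frac{e^{-xv+yu}}{u-v}\,e^{-\frac1u+\frac1v}\Big(\frac vu\Big)^{\nu+n-m}\prod_{l=1}^n\frac{u-\hat\pi_l}{v-\hat\pi_l}\prod_{k=1}^m\frac{v-\hat\theta_k}{u-\hat\theta_k},\qquad x,y\in\mathbb C,$$ and the Bessel kernel of integer order $\alpha$ is $$\mathbb K^{[\alpha]}_{\rm Bessel}(x,y)=\oint_{\Gamma'_{\rm out}}\frac{dv}{2\pi i}\oint_{\Gamma'_{\rm in}}\frac{du}{2\pi i}\,\frac{e^{-xv+yu}}{u-v}\,e^{-\frac1u+\frac1v}\Big(\frac vu\Big)^{\alpha},$$ where $\Gamma'_{\rm in}$ is any closed contour encircling $0$ and $\Gamma'_{\rm out}$ any closed contour enclosing $\Gamma'_{\rm in}$. Then $\mathbb K^{(n,m)}_{\rm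 III}$ is integrable in the sense of IIKS. Moreover, for all $x,y\in\mathbb C$, $$\mathbb K^{(n,m)}_{\rm III}(x,y)=\mathbb K^{[\nu+n-m]}_{\rm Bessel}(x,y)-\sum_{i=1}^m\tilde\Lambda^{(i)}(x)\,\tilde\Xi^{(i)}(y)+\sum_{j=1}^n\Lambda^{(j)}(x)\,\Xi^{(j)}(y),$$ where, for any closed contours $\Gamma_{\hat\theta}$ encircling $0,\hat\theta_1,\dots,\hat\theta_m$ and $\Gamma_{\hat\pi}$ encircling $0,\hat\pi_1,\dots,\hat\pi_n$, $$\tilde\Lambda^{(i)}(x)=\oint_{\Gamma_{\hat\pi}}\frac{dv}{2\pi i}\,e^{-xv+\frac1v}\,v^{\nu+n-m}\prod_{k=1}^{i-1}(v-\hat\theta_k),\qquad \Lambda^{(j)}(x)=\oint_{\Gamma_{\hat\pi}}\frac{dv}{2\pi i}\,e^{-xv+\frac1v}\,v^{\nu+n-m}\,\frac{\prod_{k=1}^m(v-\hat\theta_k)}{\prod_{l=1}^{j}(v-\hat\pi_l)},$$ $$\tilde\Xi^{(i)}(y)=\oint_{\Gamma_{\hat\theta}}\frac{du}{2\pi i}\,e^{yu-\frac1u}\,u^{-\nu-n+m}\prod_{k=1}^{i}\frac1{u-\hat\theta_k},\qquad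 \Xi^{(j)}(y)=\oint_{\Gamma_{\hat\theta}}\frac{du}{2\pi i}\,e^{yu-\frac1u}\,u^{-\nu-n+m}\,\frac{\prod_{l=1}^{j-1}(u-\hat\pi_l)}{\prod_{k=1}^{m}(u-\hat\theta_k)}.$$ -/

import Mathlib

noncomputable section

/-- A closed contour in the complex plane: a closed curve parametrised by `[0, 1]` that is
continuous and, off a finite set of parameter values, continuously differentiable with a
bounded derivative. Every closed piecewise `C¹` curve is of this form. -/
structure ClosedContour where
  toFun : ℝ → ℂ
  continuousOn : ContinuousOn toFun (Set.Icc 0 1)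
  closed : toFun 0 = toFun 1
  exists_breakpoints : ∃ (B : Finset ℝ) (C : ℝ),
    (∀ t ∈ Set.Ioo (0 : ℝ) 1 \ B, DifferentiableAt ℝ toFun t ∧ ‖deriv toFun t‖ ≤ C) ∧
    ContinuousOn (deriv toFun) (Set.Ioo (0 : ℝ) 1 \ B)

namespace ClosedContour

/-- The set of points on the contour. -/
def trace (Γ : ClosedContour) : Set ℂ := Γ.toFun '' Set.Icc 0 1

/-- The normalised contour integral `∮_Γ f(z) dz / (2πi)`. -/
def integral (Γ : ClosedContour) (f : ℂ → ℂ) : ℂ :=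
  (2 * (Real.pi : ℂ) * Complex.I)⁻¹ * ∫ t in (0 : ℝ)..1, f (Γ.toFun t) * deriv Γ.toFun t

/-- The winding number of the contour around `a` (meaningful for `a` off the contour). -/
def windingNumber (Γ : ClosedContour) (a : ℂ) : ℂ := Γ.integral fun z => (z - a)⁻¹

/-- The contour encircles the point `a` (once, counter-clockwise). -/
def Encircles (Γ : ClosedContour) (a : ℂ) : Prop :=
  a ∉ Γ.trace ∧ Γ.windingNumber a = 1

/-- The contour `Γout` encloses the contour `Γin` without intersecting it: it encircles once,
counter-clockwise, every point that lies on `Γin` or is enclosed by `Γin`. -/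
def Encloses (Γout Γin : ClosedContour) : Prop :=
  ∀ z : ℂ, z ∈ Γin.trace ∨ Γin.windingNumber z ≠ 0 → Γout.Encircles z

end ClosedContour

/-- The double contour integral of the Bessel kernel of integer order `α`. -/
def besselKernel (α : ℤ) (Γout Γin : ClosedContour) (x y : ℂ) : ℂ :=
  Γout.integral fun v => Γin.integral fun u =>
    Complex.exp (-x * v + y * u) / (u - v) * Complex.exp (-1 / u + 1 / v) * (v / u) ^ α

/-- The Bessel kernel with finite rank perturbations, as a double contour integral. -/
def perturbedBesselKernel {n m : ℕ} (ν : ℤ) (π : Fin n → ℂ) (θ : Fin m → ℂ)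
    (Γout Γin : ClosedContour) (x y : ℂ) : ℂ :=
  Γout.integral fun v => Γin.integral fun u =>
    Complex.exp (-x * v + y * u) / (u - v) * Complex.exp (-1 / u + 1 / v) *
      (v / u) ^ (ν + n - m) *
      (∏ l, (u - π l) / (v - π l)) * ∏ k, (v - θ k) / (u - θ k)

/-- The contours admissible in the perturbed Bessel kernel: `Γin` encircles the origin and all
`θ k`, and `Γout` encircles all `π l` and encloses `Γin`. -/
def AdmissibleContours {n m : ℕ} (π : Fin n → ℂ) (θ : Fin m → ℂ)
    (Γout Γin : ClosedContour) : Prop :=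
  Γin.Encircles 0 ∧ (∀ k, Γin.Encircles (θ k)) ∧ (∀ l, Γout.Encircles (π l)) ∧
    Γout.Encloses Γin

/-- `x ↦ ∮ dv/(2πi) exp(-xv + 1/v) v^(ν+n-m) ∏_{k<i} (v - θ_k)`. -/
def tildeLambda {m : ℕ} (ν : ℤ) (n : ℕ) (θ : Fin m → ℂ) (Γ : ClosedContour) (i : Fin m)
    (x : ℂ) : ℂ :=
  Γ.integral fun v =>
    Complex.exp (-x * v + 1 / v) * v ^ (ν + n - m) * ∏ k ∈ Finset.Iio i, (v - θ k)

/-- `x ↦ ∮ dv/(2πi) exp(-xv + 1/v) v^(ν+n-m) ∏_{k} (v - θ_k) / ∏_{l≤j} (v - π_l)`. -/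
def capLambda {n m : ℕ} (ν : ℤ) (π : Fin n → ℂ) (θ : Fin m → ℂ) (Γ : ClosedContour)
    (j : Fin n) (x : ℂ) : ℂ :=
  Γ.integral fun v =>
    Complex.exp (-x * v + 1 / v) * v ^ (ν + n - m) *
      ((∏ k, (v - θ k)) / ∏ l ∈ Finset.Iic j, (v - π l))

/-- `y ↦ ∮ du/(2πi) exp(yu - 1/u) u^(-ν-n+m) ∏_{k≤i} 1/(u - θ_k)`. -/
def tildeXi {m : ℕ} (ν : ℤ) (n : ℕ) (θ : Fin m → ℂ) (Γ : ClosedContour) (i : Fin m)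
    (y : ℂ) : ℂ :=
  Γ.integral fun u =>
    Complex.exp (y * u - 1 / u) * u ^ (-ν - n + m) * ∏ k ∈ Finset.Iic i, 1 / (u - θ k)

/-- `y ↦ ∮ du/(2πi) exp(yu - 1/u) u^(-ν-n+m) ∏_{l<j} (u - π_l) / ∏_{k} (u - θ_k)`. -/
def capXi {n m : ℕ} (ν : ℤ) (π : Fin n → ℂ) (θ : Fin m → ℂ) (Γ : ClosedContour)
    (j : Fin n) (y : ℂ) : ℂ :=
  Γ.integral fun u =>
    Complex.exp (y * u - 1 / u) * u ^ (-ν - n + m) *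
      ((∏ l ∈ Finset.Iio j, (u - π l)) / ∏ k, (u - θ k))

/-- A kernel is integrable in the sense of Its, Izergin, Korepin and Slavnov if
`K(x,y) = ∑_l F_l(x) G_l(y) / (x - y)` for finitely many functions `F_l`, `G_l` with
`∑_l F_l(x) G_l(x) = 0`. -/
def IsIIKSIntegrable (K : ℂ → ℂ → ℂ) : Prop :=
  ∃ (L : ℕ) (F G : Fin L → ℂ → ℂ),
    (∀ x y : ℂ, x ≠ y → K x y = ∑ l, F l x * G l y / (x - y)) ∧
    ∀ x : ℂ, ∑ l, F l x * G l x = 0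

end

/-! Write the Bessel integrand as `A(v) B(u) / (u - v)` with `α = ν + n - m`, `A(v) = exp(-xv + 1/v)
v^α` and `B(u) = exp(yu - 1/u) u^(-α)`. The numerators and denominators of the extra quotients
differ by `±(u - v)`, so both products telescope (`prod_div_eq_one_add_sum`). Every correction term
carries a factor `u - v`, which cancels the Cauchy denominator and leaves a product of a function of
`v` and a function of `u`. The double integral is thus the Bessel kernel plus products of single
integrals (`perturbedBesselKernel_eq`).

The contours are arbitrary, so their independence rests on winding numbers rather than deformation.
Splitting off principal parts as entire functions of `(z - a)⁻¹` (`exists_principalPart`) gives a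
residue theorem for isolated, possibly essential, singularities (`exists_residues`). For the Bessel
kernel, write `B(u) = g(u) + P(1/u)`. Since the inner contour does not wind around points of the
outer one, the inner integral is `-P(1/v)`, and a single integral of a function holomorphic off `0`
remains.

For integrability it suffices that `(x - y) K(x, y)` has finite rank: the diagonal condition is then
the value at `x = y`. For the Bessel kernel this follows by integrating the `v`-derivative of `A(v)
· (-P(1/v))` over a closed contour (`sub_mul_besselKernel`). A product `F(x) G(y)` keeps finite rank
when multiplied by `x - y`. -/

open Complex Metric Set Filter Topology

/-! ### Cauchy transforms on circles and the Laurent decomposition -/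

/-- The Cauchy transform of a continuous function on a circle. -/
noncomputable def circleCauchyTransform (f : ℂ → ℂ) (a : ℂ) (r : ℝ) (z : ℂ) : ℂ :=
  (2 * (Real.pi : ℂ) * I)⁻¹ * ∮ w in C(a, r), (w - z)⁻¹ * f w

theorem differentiableAt_circleCauchyTransform {f : ℂ → ℂ} {a : ℂ} {r : ℝ} (hr : 0 ≤ r)
    (hf : ContinuousOn f (sphere a r)) {z : ℂ} (hz : z ∉ sphere a r) :
    DifferentiableAt ℂ (circleCauchyTransform f a r) z := by
  refine DifferentiableAt.const_mul ?_ _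
  obtain ⟨δ, hδ, hball⟩ := Metric.isOpen_iff.1 (isClosed_sphere (x := a) (ε := r)).isOpen_compl z hz
  obtain ⟨M, hM⟩ := (isCompact_sphere a r).exists_bound_of_continuousOn hf
  have hfc : Continuous fun t => f (circleMap a r t) :=
    hf.comp_continuous (continuous_circleMap a r) fun t => circleMap_mem_sphere a hr t
  -- On the half-size ball the distance to the circle stays at least `δ / 2`, which gives the
  -- uniform bound needed to differentiate under the integral.
  have hne : ∀ x ∈ ball z (δ / 2), ∀ t, δ / 2 ≤ ‖circleMap a r t - x‖ := by
    intro x hx t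
    by_contra! h
    refine hball (a := circleMap a r t) ?_ (circleMap_mem_sphere a hr t)
    rw [mem_ball, dist_eq_norm] at *
    calc ‖circleMap a r t - z‖ = ‖(circleMap a r t - x) + (x - z)‖ := by ring_nf
      _ ≤ _ := norm_add_le _ _
      _ < δ := by linarith
  have hne' : ∀ x ∈ ball z (δ / 2), ∀ t, circleMap a r t - x ≠ 0 := fun x hx t h => by
    have := hne x hx t
    rw [h, norm_zero] at this
    linarith
  have hcont : ∀ x ∈ ball z (δ / 2), Continuous fun t : ℝ =>
      deriv (circleMap a r) t • ((circleMap a r t - x)⁻¹ * f (circleMap a r t)) := by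
    intro x hx
    simp only [deriv_circleMap]
    refine ((continuous_circleMap 0 r).mul continuous_const).smul (Continuous.mul ?_ hfc)
    exact ((continuous_circleMap a r).sub continuous_const).inv₀ (hne' x hx)
  have hz' : z ∈ ball z (δ / 2) := mem_ball_self (by positivity)
  refine (intervalIntegral.hasDerivAt_integral_of_dominated_loc_of_deriv_le
    (F := fun x t => deriv (circleMap a r) t • ((circleMap a r t - x)⁻¹ * f (circleMap a r t)))
    (F' := fun x t => deriv (circleMap a r) t •
      ((circleMap a r t - x)⁻¹ ^ 2 * f (circleMap a r t)))
    (bound := fun _ => r * ((δ / 2)⁻¹ ^ 2 * M)) (ball_mem_nhds z (half_pos hδ))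
    ?_ ((hcont z hz').intervalIntegrable _ _) ?_ ?_ ?_ ?_).2.differentiableAt
  · filter_upwards [ball_mem_nhds z (half_pos hδ)] with x hx
    exact (hcont x hx).aestronglyMeasurable
  · refine Continuous.aestronglyMeasurable ?_
    simp only [deriv_circleMap]
    refine ((continuous_circleMap 0 r).mul continuous_const).smul (Continuous.mul ?_ hfc)
    exact (((continuous_circleMap a r).sub continuous_const).inv₀ (hne' z hz')).pow 2
  · refine Eventually.of_forall fun t _ x hx => ?_
    rw [norm_smul, norm_mul, norm_pow, norm_inv, deriv_circleMap, norm_mul, norm_I, mul_one,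
      norm_circleMap_zero, abs_of_nonneg hr]
    have h1 := hne x hx t
    have h2 := hM _ (circleMap_mem_sphere a hr t)
    gcongr
  · exact intervalIntegrable_const
  · refine Eventually.of_forall fun t _ x hx => ?_
    have h := (((hasDerivAt_id x).const_sub (circleMap a r t)).fun_inv (hne' x hx t)).mul_const
      (f (circleMap a r t))
    refine (h.const_smul (deriv (circleMap a r) t)).congr_deriv ?_
    simp [div_eq_mul_inv]

theorem norm_circleCauchyTransform_le {f : ℂ → ℂ} {a : ℂ} {r M : ℝ} (hr : 0 ≤ r)
    (hM : ∀ w ∈ sphere a r, ‖f w‖ ≤ M) {z : ℂ} (hz : r < ‖z - a‖) :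
    ‖circleCauchyTransform f a r z‖ ≤ r * ((‖z - a‖ - r)⁻¹ * M) := by
  rw [circleCauchyTransform, ← smul_eq_mul]
  refine circleIntegral.norm_two_pi_i_inv_smul_integral_le_of_norm_le_const hr fun w hw => ?_
  have h : ‖z - a‖ - r ≤ ‖w - z‖ := by
    have h1 := norm_sub_norm_le (z - a) (w - a)
    rw [mem_sphere_iff_norm.1 hw] at h1
    rw [norm_sub_rev w z]
    simpa using h1
  have h2 := sub_pos.2 hz
  rw [norm_mul, norm_inv]
  have := hM w hw
  gcongr

/-- Cauchy's formula on an annulus: the difference quotient of `f` at `z` has the same integral over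
both circles, while `(w - z)⁻¹` integrates to `2πi` over the outer circle and to `0` over the inner
one. -/
theorem eq_circleCauchyTransform_sub {f : ℂ → ℂ} {a z : ℂ} {r R : ℝ} (hr : 0 < r)
    (hrz : r < ‖z - a‖) (hzR : ‖z - a‖ < R)
    (hf : ∀ w, r ≤ ‖w - a‖ → ‖w - a‖ ≤ R → DifferentiableAt ℂ f w) :
    f z = circleCauchyTransform f a R z - circleCauchyTransform f a r z := by
  have hrR : r < R := hrz.trans hzR
  have key : (∮ w in C(a, R), dslope f z w) = ∮ w in C(a, r), dslope f z w := by
    refine circleIntegral_eq_of_differentiable_on_annulus_off_countable hr hrR.le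
      (countable_singleton z) (fun w hw => ?_) fun w hw => ?_
    · have hw' := hf w (by simpa [dist_eq_norm] using hw.2) (by simpa [dist_eq_norm] using hw.1)
      rcases eq_or_ne w z with rfl | hwz
      · exact (continuousAt_dslope_same.2 hw').continuousWithinAt
      · exact ((continuousAt_dslope_of_ne hwz).2 hw'.continuousAt).continuousWithinAt
    · have hw' := hf w (le_of_lt (by simpa [dist_eq_norm] using hw.1.2))
        (le_of_lt (by simpa [dist_eq_norm] using hw.1.1))
      exact (differentiableAt_dslope_of_ne hw.2).2 hw'
  have hsp : ∀ ρ, 0 < ρ → r ≤ ρ → ρ ≤ R → ρ ≠ ‖z - a‖ →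
      (∮ w in C(a, ρ), dslope f z w) =
        (∮ w in C(a, ρ), (w - z)⁻¹ * f w) - (∮ w in C(a, ρ), (w - z)⁻¹) * f z := by
    intro ρ hρ hrρ hρR hρz
    have hne : ∀ w ∈ sphere a ρ, w - z ≠ 0 := fun w hw h => hρz <| by
      rw [← mem_sphere_iff_norm.1 hw, sub_eq_zero.1 h]
    have hinv : ContinuousOn (fun w => (w - z)⁻¹) (sphere a ρ) :=
      ((continuous_id.sub continuous_const).continuousOn).inv₀ hne
    have hfs : ContinuousOn f (sphere a ρ) := fun w hw =>
      (hf w (by rw [mem_sphere_iff_norm.1 hw]; exact hrρ)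
        (by rw [mem_sphere_iff_norm.1 hw]; exact hρR)).continuousAt.continuousWithinAt
    have h1 := circleIntegral.integral_smul_const (fun w => (w - z)⁻¹) (f z) a ρ
    simp only [smul_eq_mul] at h1
    rw [← h1, ← circleIntegral.integral_sub (f := fun w => (w - z)⁻¹ * f w)
      (g := fun w => (w - z)⁻¹ * f z) ((hinv.mul hfs).circleIntegrable hρ.le)
      ((hinv.mul continuousOn_const).circleIntegrable hρ.le)]
    refine circleIntegral.integral_congr hρ.le fun w hw => ?_
    have : w ≠ z := sub_ne_zero.1 (hne w hw)
    simp only [dslope_of_ne _ this, slope_def_field]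
    field_simp
  have h1 : (∮ w in C(a, R), (w - z)⁻¹) = 2 * Real.pi * I :=
    circleIntegral.integral_sub_inv_of_mem_ball (mem_ball_iff_norm.2 hzR)
  have h2 : (∮ w in C(a, r), (w - z)⁻¹) = 0 := by
    refine DiffContOnCl.circleIntegral_eq_zero hr.le (DifferentiableOn.diffContOnCl ?_)
    rw [closure_ball a hr.ne']
    intro w hw
    refine DifferentiableAt.differentiableWithinAt (DifferentiableAt.inv (by fun_prop) fun h => ?_)
    rw [sub_eq_zero.1 h, mem_closedBall_iff_norm] at hw
    linarith
  rw [hsp R (hr.trans hrR) hrR.le le_rfl hzR.ne', hsp r hr le_rfl hrR.le hrz.ne, h1, h2] at key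
  have hpi : (2 * (Real.pi : ℂ) * I) ≠ 0 := two_pi_I_ne_zero
  simp only [circleCauchyTransform]
  rw [← mul_sub, eq_inv_mul_iff_mul_eq₀ hpi]
  linear_combination -key

/-- Laurent decomposition at an isolated singularity: the principal part is an entire function of
`(z - a)⁻¹` vanishing at infinity. -/
theorem exists_principalPart {U : Set ℂ} (hU : IsOpen U) {a : ℂ} (ha : a ∈ U) {f : ℂ → ℂ}
    (hf : DifferentiableOn ℂ f (U \ {a})) :
    ∃ g P : ℂ → ℂ, DifferentiableOn ℂ g U ∧ Differentiable ℂ P ∧ P 0 = 0 ∧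
      ∀ z ∈ U, z ≠ a → f z = g z + P (z - a)⁻¹ := by
  obtain ⟨R, hR, hball⟩ := Metric.nhds_basis_closedBall.mem_iff.1 (hU.mem_nhds ha)
  have hfd : ∀ z ∈ U, z ≠ a → DifferentiableAt ℂ f z := fun z hz hza =>
    hf.differentiableAt ((hU.sdiff isClosed_singleton).mem_nhds ⟨hz, hza⟩)
  set r := R / 2
  have hr : 0 < r := half_pos hR
  have hrR : r < R := half_lt_self hR
  have hfb : ∀ w, 0 < ‖w - a‖ → ‖w - a‖ ≤ R → DifferentiableAt ℂ f w := fun w h h' =>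
    hfd w (hball (mem_closedBall_iff_norm.2 h')) (sub_ne_zero.1 (norm_pos_iff.1 h))
  have hfs : ∀ ρ, 0 < ρ → ρ ≤ R → ContinuousOn f (sphere a ρ) := fun ρ hρ hρR w hw => by
    rw [mem_sphere_iff_norm] at hw
    exact (hfb w (hw ▸ hρ) (hw ▸ hρR)).continuousAt.continuousWithinAt
  have hTd : ∀ ρ, 0 < ρ → ρ ≤ R → ∀ z, ‖z - a‖ ≠ ρ →
      DifferentiableAt ℂ (circleCauchyTransform f a ρ) z := fun ρ hρ hρR z hz =>
    differentiableAt_circleCauchyTransform hρ.le (hfs ρ hρ hρR) (by simpa [dist_eq_norm] using hz)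
  -- The principal part, glued from two formulas that agree on the annulus `r < ‖z - a‖ < R` by
  -- Cauchy's formula; it is therefore holomorphic off `a`.
  let p : ℂ → ℂ := fun z => if ‖z - a‖ < R then f z - circleCauchyTransform f a R z
    else -circleCauchyTransform f a r z
  have hp1 : ∀ z, ‖z - a‖ < R → p z = f z - circleCauchyTransform f a R z := fun z hz => if_pos hz
  have hp2 : ∀ z, r < ‖z - a‖ → p z = -circleCauchyTransform f a r z := by
    intro z hz
    by_cases h : ‖z - a‖ < R
    · rw [hp1 z h, eq_circleCauchyTransform_sub hr hz h fun w h1 h2 => hfb w (hr.trans_le h1) h2]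
      ring
    · exact if_neg h
  have hcn : Continuous fun z : ℂ => ‖z - a‖ := by fun_prop
  have hlt : ∀ {z : ℂ}, ‖z - a‖ < R → ∀ᶠ w in 𝓝 z, ‖w - a‖ < R := fun h =>
    hcn.continuousAt.eventually_lt continuousAt_const h
  have hpd : ∀ z, z ≠ a → DifferentiableAt ℂ p z := by
    intro z hz
    by_cases h : ‖z - a‖ < R
    · have h1 := (hfb z (norm_pos_iff.2 (sub_ne_zero.2 hz)) h.le).sub (hTd R hR le_rfl z h.ne)
      refine h1.congr_of_eventuallyEq ?_
      filter_upwards [hlt h] with w hw using hp1 w hw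
    · have h' : r < ‖z - a‖ := hrR.trans_le (not_lt.1 h)
      refine (hTd r hr hrR.le z h'.ne').neg.congr_of_eventuallyEq ?_
      filter_upwards [continuousAt_const.eventually_lt hcn.continuousAt h'] with w hw using hp2 w hw
  let P : ℂ → ℂ := fun s => if s = 0 then 0 else p (a + s⁻¹)
  have hPne : ∀ s, s ≠ 0 → P s = p (a + s⁻¹) := fun s hs => if_neg hs
  have hP0 : P 0 = 0 := if_pos rfl
  have hPd : ∀ s, s ≠ 0 → DifferentiableAt ℂ P s := by
    intro s hs
    have h1 : DifferentiableAt ℂ (fun s : ℂ => a + s⁻¹) s :=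
      (differentiableAt_inv hs).const_add a
    have h2 : DifferentiableAt ℂ p (a + s⁻¹) := hpd _ (by simpa using hs)
    refine (h2.comp s h1).congr_of_eventuallyEq ?_
    filter_upwards [isOpen_ne.mem_nhds hs] with w hw using hPne w hw
  -- The Cauchy transform over the small circle decays at infinity, so `P` is continuous at `0` and
  -- the singularity there is removable.
  have hPc : ContinuousAt P 0 := by
    obtain ⟨M, hM⟩ := (isCompact_sphere a r).exists_bound_of_continuousOn (hfs r hr hrR.le)
    rw [continuousAt_iff_punctured_nhds, hP0]
    have hinv : Tendsto (fun s : ℂ => ‖s⁻¹‖) (𝓝[≠] 0) atTop :=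
      tendsto_norm_cobounded_atTop.comp tendsto_inv₀_nhdsNE_zero
    have hlim : Tendsto (fun s : ℂ => r * ((‖s⁻¹‖ - r)⁻¹ * M)) (𝓝[≠] 0) (𝓝 0) := by
      have := (tendsto_inv_atTop_zero.comp (tendsto_atTop_add_const_right _ (-r) hinv))
      simpa [sub_eq_add_neg] using (this.mul_const M).const_mul r
    refine squeeze_zero_norm' ?_ hlim
    filter_upwards [hinv.eventually_gt_atTop r, self_mem_nhdsWithin] with s hs hs0
    rw [hPne s hs0, hp2 _ (by simpa using hs), norm_neg]
    simpa using norm_circleCauchyTransform_le hr.le hM (z := a + s⁻¹) (by simpa using hs)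
  let g : ℂ → ℂ := fun z => if ‖z - a‖ < R then circleCauchyTransform f a R z else f z - p z
  have hg : ∀ z, z ≠ a → g z = f z - p z := by
    intro z hz
    by_cases h : ‖z - a‖ < R
    · rw [hp1 z h]
      simp [g, h]
    · exact if_neg h
  refine ⟨g, P, fun z hz => DifferentiableAt.differentiableWithinAt ?_, fun s => ?_, hP0,
    fun z hz hza => ?_⟩
  · by_cases h : ‖z - a‖ < R
    · refine (hTd R hR le_rfl z h.ne).congr_of_eventuallyEq ?_
      filter_upwards [hlt h] with w hw using if_pos hw
    · have hza : z ≠ a := by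
        rintro rfl
        simp [hR] at h
      refine ((hfd z hz hza).sub (hpd z hza)).congr_of_eventuallyEq ?_
      filter_upwards [isOpen_ne.mem_nhds hza] with w hw using hg w hw
  · rcases eq_or_ne s 0 with rfl | hs
    · refine (analyticAt_of_differentiable_on_punctured_nhds_of_continuousAt ?_ hPc).differentiableAt
      filter_upwards [self_mem_nhdsWithin] with s hs using hPd s hs
    · exact hPd s hs
  · rw [hPne _ (inv_ne_zero (sub_ne_zero.2 hza)), hg z hza]
    simp

/-! ### Integrals along closed contours and the residue theorem -/

namespace ClosedContour

variable {Γ : ClosedContour} {f g : ℂ → ℂ}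

theorem apply_mem_trace (Γ : ClosedContour) {t : ℝ} (ht : t ∈ Icc (0 : ℝ) 1) :
    Γ.toFun t ∈ Γ.trace := mem_image_of_mem _ ht

theorem intervalIntegrable_of_continuousOn (hf : ContinuousOn f Γ.trace) :
    IntervalIntegrable (fun t => f (Γ.toFun t) * deriv Γ.toFun t) MeasureTheory.volume 0 1 := by
  obtain ⟨B, C, hB, hc⟩ := Γ.exists_breakpoints
  have hcomp : ContinuousOn (fun t => f (Γ.toFun t)) (Icc 0 1) :=
    hf.comp Γ.continuousOn fun t ht => Γ.apply_mem_trace ht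
  have hd : IntervalIntegrable (deriv Γ.toFun) MeasureTheory.volume 0 1 := by
    rw [intervalIntegrable_iff_integrableOn_Ioo_of_le zero_le_one]
    -- The breakpoints form a null set, so a bounded continuous derivative off them is integrable.
    have hae : (Ioo (0 : ℝ) 1 \ B : Set ℝ) =ᵐ[MeasureTheory.volume] Ioo (0 : ℝ) 1 :=
      MeasureTheory.sdiff_null_ae_eq_self (B.finite_toSet.measure_zero _)
    refine MeasureTheory.IntegrableOn.congr_set_ae (t := Ioo (0 : ℝ) 1 \ B) ?_ hae.symm
    have hm : MeasurableSet (Ioo (0 : ℝ) 1 \ B) :=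
      measurableSet_Ioo.diff B.finite_toSet.measurableSet
    have hlt : MeasureTheory.volume (Ioo (0 : ℝ) 1 \ B) < ⊤ :=
      (MeasureTheory.measure_mono sdiff_subset).trans_lt (by simp)
    exact MeasureTheory.IntegrableOn.of_bound hlt (hc.aestronglyMeasurable hm) C
      ((MeasureTheory.ae_restrict_iff' hm).2 (Eventually.of_forall fun t ht => (hB t ht).2))
  refine hd.continuousOn_mul ?_
  rwa [uIcc_of_le zero_le_one]

theorem integral_congr (h : ∀ z ∈ Γ.trace, f z = g z) : Γ.integral f = Γ.integral g := by
  rw [integral, integral]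
  congr 1
  refine intervalIntegral.integral_congr fun t ht => ?_
  rw [uIcc_of_le zero_le_one] at ht
  simp only [h _ (Γ.apply_mem_trace ht)]

theorem integral_add (hf : ContinuousOn f Γ.trace) (hg : ContinuousOn g Γ.trace) :
    (Γ.integral fun z => f z + g z) = Γ.integral f + Γ.integral g := by
  simp only [integral, add_mul]
  rw [intervalIntegral.integral_add (intervalIntegrable_of_continuousOn hf)
    (intervalIntegrable_of_continuousOn hg), mul_add]

theorem integral_const_mul (c : ℂ) (f : ℂ → ℂ) :
    (Γ.integral fun z => c * f z) = c * Γ.integral f := by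
  simp only [integral, mul_assoc, intervalIntegral.integral_const_mul]
  ring

theorem integral_mul_const (c : ℂ) (f : ℂ → ℂ) :
    (Γ.integral fun z => f z * c) = Γ.integral f * c := by
  simp only [mul_comm _ c, integral_const_mul]

theorem integral_sub (hf : ContinuousOn f Γ.trace) (hg : ContinuousOn g Γ.trace) :
    (Γ.integral fun z => f z - g z) = Γ.integral f - Γ.integral g := by
  simp only [integral, sub_mul]
  rw [intervalIntegral.integral_sub (intervalIntegrable_of_continuousOn hf)
    (intervalIntegrable_of_continuousOn hg), mul_sub]

theorem integral_sum {ι : Type*} (s : Finset ι) {f : ι → ℂ → ℂ}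
    (hf : ∀ i ∈ s, ContinuousOn (f i) Γ.trace) :
    (Γ.integral fun z => ∑ i ∈ s, f i z) = ∑ i ∈ s, Γ.integral (f i) := by
  simp only [integral, Finset.sum_mul]
  rw [intervalIntegral.integral_finsetSum fun i hi => intervalIntegrable_of_continuousOn (hf i hi),
    Finset.mul_sum]

/-- The integral of a derivative along a closed contour vanishes. -/
theorem integral_eq_zero_of_hasDerivAt {F : ℂ → ℂ} (hF : ∀ z ∈ Γ.trace, HasDerivAt F (f z) z)
    (hf : ContinuousOn f Γ.trace) : Γ.integral f = 0 := by
  obtain ⟨B, C, hB, hc⟩ := Γ.exists_breakpoints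
  have h := MeasureTheory.integral_eq_of_hasDerivAt_off_countable_of_le
    (fun t => F (Γ.toFun t)) (fun t => f (Γ.toFun t) * deriv Γ.toFun t) zero_le_one
    B.countable_toSet ?_ ?_ (intervalIntegrable_of_continuousOn hf)
  · rw [integral, h, Γ.closed, sub_self, mul_zero]
  · intro t ht
    exact (hF _ (Γ.apply_mem_trace ht)).continuousAt.comp_continuousWithinAt (Γ.continuousOn t ht)
  · intro t ht
    exact (hF _ (Γ.apply_mem_trace (Ioo_subset_Icc_self ht.1))).comp t (hB t ht).1.hasDerivAt

theorem integral_eq_zero_of_differentiable (hf : Differentiable ℂ f) : Γ.integral f = 0 := by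
  obtain ⟨F, hF⟩ := hf.isExactOn_univ
  exact integral_eq_zero_of_hasDerivAt (fun z _ => hF z (mem_univ z)) hf.continuous.continuousOn

/-- If `q' = Q`, then `-q((z - a)⁻¹)` is a primitive of the integrand along the contour. -/
theorem integral_comp_inv_sub_mul_sq_eq_zero {Q : ℂ → ℂ} (hQ : Differentiable ℂ Q) {a : ℂ}
    (ha : a ∉ Γ.trace) : (Γ.integral fun z => (z - a)⁻¹ ^ 2 * Q (z - a)⁻¹) = 0 := by
  obtain ⟨q, hq⟩ := hQ.isExactOn_univ
  have hne : ∀ z ∈ Γ.trace, z - a ≠ 0 := fun z hz h => ha (sub_eq_zero.1 h ▸ hz)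
  have hinv : ContinuousOn (fun z => (z - a)⁻¹) Γ.trace :=
    (by fun_prop : Continuous fun z : ℂ => z - a).continuousOn.inv₀ hne
  refine integral_eq_zero_of_hasDerivAt (F := fun z => -q (z - a)⁻¹) (fun z hz => ?_)
    ((hinv.pow 2).mul (hQ.continuous.comp_continuousOn hinv))
  have h1 := ((hasDerivAt_id z).sub_const a).fun_inv (hne z hz)
  have h2 := ((hq _ (mem_univ (z - a)⁻¹)).comp z h1).neg
  refine h2.congr_deriv ?_
  simp [div_eq_mul_inv]
  ring

/-- Expand `P(w) = P'(0) w + w² Q(w)` with `Q` entire: the linear term gives the residue `P'(0)`,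
and the remainder has a primitive. -/
theorem integral_comp_inv_sub {P : ℂ → ℂ} (hP : Differentiable ℂ P) (hP0 : P 0 = 0) {a : ℂ}
    (ha : a ∉ Γ.trace) :
    (Γ.integral fun z => P (z - a)⁻¹) = deriv P 0 * Γ.windingNumber a := by
  have hd : ∀ {h : ℂ → ℂ}, Differentiable ℂ h → Differentiable ℂ (dslope h 0) := fun hh =>
    differentiableOn_univ.1 ((differentiableOn_dslope univ_mem).2 (differentiableOn_univ.2 hh))
  have hne : ∀ z ∈ Γ.trace, z - a ≠ 0 := fun z hz h => ha (sub_eq_zero.1 h ▸ hz)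
  have hinv : ContinuousOn (fun z => (z - a)⁻¹) Γ.trace :=
    (by fun_prop : Continuous fun z : ℂ => z - a).continuousOn.inv₀ hne
  have hQ : Differentiable ℂ (dslope (dslope P 0) 0) := hd (hd hP)
  rw [integral_congr (g := fun z => deriv P 0 * (z - a)⁻¹ +
      (z - a)⁻¹ ^ 2 * dslope (dslope P 0) 0 (z - a)⁻¹) fun z hz => ?_,
    integral_add (f := fun z => deriv P 0 * (z - a)⁻¹)
      (g := fun z => (z - a)⁻¹ ^ 2 * dslope (dslope P 0) 0 (z - a)⁻¹)
      (continuousOn_const.mul hinv) ((hinv.pow 2).mul (hQ.continuous.comp_continuousOn hinv)),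
    integral_const_mul, integral_comp_inv_sub_mul_sq_eq_zero hQ ha, add_zero]
  · rfl
  · have h0 := inv_ne_zero (hne z hz)
    rw [dslope_of_ne _ h0, slope_def_field, dslope_of_ne _ h0, slope_def_field, dslope_same, hP0]
    generalize (z - a)⁻¹ = w at h0
    field_simp
    ring

/-- The residue theorem for functions that are holomorphic off a finite set. -/
theorem exists_residues (S : Finset ℂ) : ∀ f : ℂ → ℂ, DifferentiableOn ℂ f (S : Set ℂ)ᶜ →
    ∃ c : ℂ → ℂ, ∀ Γ : ClosedContour, (∀ a ∈ S, a ∉ Γ.trace) →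
      Γ.integral f = ∑ a ∈ S, c a * Γ.windingNumber a := by
  induction S using Finset.induction_on with
  | empty =>
    intro f hf
    refine ⟨0, fun Γ _ => ?_⟩
    simpa using integral_eq_zero_of_differentiable (differentiableOn_univ.1 (by simpa using hf))
  | insert a S haS ih =>
    intro f hf
    have hU : IsOpen (S : Set ℂ)ᶜ := S.finite_toSet.isClosed.isOpen_compl
    have hset : ((insert a S : Finset ℂ) : Set ℂ)ᶜ = (S : Set ℂ)ᶜ \ {a} := by
      ext z
      simp [not_or, and_comm]
    rw [hset] at hf
    obtain ⟨g, P, hg, hP, hP0, hfg⟩ := exists_principalPart hU (a := a) (by simpa using haS) hf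
    obtain ⟨c, hc⟩ := ih g hg
    -- The residue at the new point is `P'(0)`; the regular part `g` is holomorphic at `a` and
    -- supplies the others by induction.
    refine ⟨Function.update c a (deriv P 0), fun Γ hΓ => ?_⟩
    have hΓS : ∀ b ∈ S, b ∉ Γ.trace := fun b hb => hΓ b (Finset.mem_insert_of_mem hb)
    have haΓ : a ∉ Γ.trace := hΓ a (Finset.mem_insert_self a S)
    have hsub : Γ.trace ⊆ (S : Set ℂ)ᶜ := fun z hz hzS => hΓS z hzS hz
    have hne : ∀ z ∈ Γ.trace, z ≠ a := fun z hz h => haΓ (h ▸ hz)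
    have hinv : ContinuousOn (fun z => (z - a)⁻¹) Γ.trace :=
      (by fun_prop : Continuous fun z : ℂ => z - a).continuousOn.inv₀
        fun z hz => sub_ne_zero.2 (hne z hz)
    rw [integral_congr fun z hz => hfg z (hsub hz) (hne z hz),
      integral_add (g := fun z => P (z - a)⁻¹) (hg.continuousOn.mono hsub)
        (hP.continuous.comp_continuousOn hinv),
      hc Γ hΓS, integral_comp_inv_sub hP hP0 haΓ, Finset.sum_insert haS, Function.update_self,
      add_comm]
    congr 1
    refine Finset.sum_congr rfl fun b hb => ?_
    rw [Function.update_of_ne (ne_of_mem_of_not_mem hb haS)]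

/-- Two contours that encircle all singularities of a function give the same integral. -/
theorem integral_eq_of_encircles {S : Finset ℂ} (hf : DifferentiableOn ℂ f (S : Set ℂ)ᶜ)
    {Γ₁ Γ₂ : ClosedContour} (h₁ : ∀ a ∈ S, Γ₁.Encircles a) (h₂ : ∀ a ∈ S, Γ₂.Encircles a) :
    Γ₁.integral f = Γ₂.integral f := by
  obtain ⟨c, hc⟩ := exists_residues S f hf
  rw [hc Γ₁ fun a ha => (h₁ a ha).1, hc Γ₂ fun a ha => (h₂ a ha).1]
  exact Finset.sum_congr rfl fun a ha => by rw [(h₁ a ha).2, (h₂ a ha).2]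

/-- The Cauchy integral of a function with a single singularity at the origin, evaluated outside
the contour, is minus the principal part. -/
theorem integral_div_sub_eq_neg_principalPart {P : ℂ → ℂ} (hg : Differentiable ℂ g)
    (hP : Differentiable ℂ P) (hP0 : P 0 = 0) (hf : ∀ z, z ≠ 0 → f z = g z + P z⁻¹)
    (h0 : Γ.Encircles 0) {v : ℂ} (hv : v ∉ Γ.trace) (hwv : Γ.windingNumber v = 0) :
    (Γ.integral fun u => f u / (u - v)) = -P v⁻¹ := by
  have hd : ∀ {h : ℂ → ℂ} (b : ℂ), Differentiable ℂ h → Differentiable ℂ (dslope h b) := fun b hh =>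
    differentiableOn_univ.1 ((differentiableOn_dslope univ_mem).2 (differentiableOn_univ.2 hh))
  have hv0 : v ≠ 0 := by
    rintro rfl
    exact one_ne_zero (h0.2.symm.trans hwv)
  have hne : ∀ u ∈ Γ.trace, u ≠ 0 := fun u hu h => h0.1 (h ▸ hu)
  have hnv : ∀ u ∈ Γ.trace, u ≠ v := fun u hu h => hv (h ▸ hu)
  have hs : v⁻¹ ≠ 0 := inv_ne_zero hv0
  -- Since `1/u - 1/v = -(u - v)/(uv)`, the quotient `(P(1/u) - P(1/v))/(u - v)` equals `-v⁻¹
  -- R(1/u)`. Its residue at `0` is `-v⁻¹ R'(0) = -P(1/v)`, because `P 0 = 0`.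
  let R : ℂ → ℂ := fun w => w * dslope P v⁻¹ w
  have hR : Differentiable ℂ R := differentiable_id.mul (hd _ hP)
  have hR0 : R 0 = 0 := zero_mul _
  have hRd : deriv R 0 = P v⁻¹ * v := by
    have h := (hasDerivAt_id (0 : ℂ)).mul (hd v⁻¹ hP 0).hasDerivAt
    have h' : deriv R 0 = _ := h.deriv
    rw [h', dslope_of_ne _ hs.symm, slope_def_field, hP0]
    simp
  have hinv : ContinuousOn (fun z : ℂ => (z - 0)⁻¹) Γ.trace := by
    simpa using continuousOn_inv₀.mono hne
  have hinvv : ContinuousOn (fun z : ℂ => (z - v)⁻¹) Γ.trace :=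
    (by fun_prop : Continuous fun z : ℂ => z - v).continuousOn.inv₀
      fun z hz => sub_ne_zero.2 (hnv z hz)
  have hRc : ContinuousOn (fun u : ℂ => R (u - 0)⁻¹) Γ.trace :=
    hR.continuous.comp_continuousOn hinv
  -- The first term is entire and the second is killed by the zero winding number about `v`; only
  -- the last contributes.
  rw [integral_congr (g := fun u => (dslope g v u + (g v + P v⁻¹) * (u - v)⁻¹) +
      -v⁻¹ * R (u - 0)⁻¹) fun u hu => ?_,
    integral_add (f := fun u => dslope g v u + (g v + P v⁻¹) * (u - v)⁻¹)
      (g := fun u => -v⁻¹ * R (u - 0)⁻¹)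
      ((hd v hg).continuous.continuousOn.add (continuousOn_const.mul hinvv))
      (continuousOn_const.mul hRc),
    integral_add (g := fun u => (g v + P v⁻¹) * (u - v)⁻¹)
      (hd v hg).continuous.continuousOn
      (continuousOn_const.mul hinvv),
    integral_eq_zero_of_differentiable (hd v hg), integral_const_mul, integral_const_mul,
    integral_comp_inv_sub hR hR0 h0.1, h0.2, hRd]
  · change 0 + _ * Γ.windingNumber v + _ = _
    rw [hwv]
    field_simp
    ring
  · have hu0 := hne u hu
    have huv := hnv u hu
    have huv' := sub_ne_zero.2 huv
    have hi : u⁻¹ ≠ v⁻¹ := fun h => huv (inv_injective h)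
    have hi' : v - u ≠ 0 := sub_ne_zero.2 huv.symm
    have hii : u⁻¹ - v⁻¹ = (v - u) / (u * v) := by field_simp
    simp only [R, sub_zero]
    rw [hf u hu0, dslope_of_ne _ huv, slope_def_field, dslope_of_ne _ hi, slope_def_field, hii]
    field_simp
    ring

end ClosedContour

/-! ### The Bessel kernel: reduction to a single integral and integration by parts -/

/-- The outer factor `exp(-xv + 1/v) v^α` of the integrand of the Bessel kernel. -/
noncomputable def besselOuter (α : ℤ) (x v : ℂ) : ℂ := exp (-x * v + 1 / v) * v ^ α

/-- The inner factor `exp(yu - 1/u) u^(-α)` of the integrand of the Bessel kernel. -/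
noncomputable def besselInner (α : ℤ) (y u : ℂ) : ℂ := exp (y * u - 1 / u) * u ^ (-α)

theorem hasDerivAt_besselOuter (α : ℤ) (x : ℂ) {v : ℂ} (hv : v ≠ 0) :
    HasDerivAt (besselOuter α x) ((-x - v⁻¹ ^ 2 + α * v⁻¹) * besselOuter α x v) v := by
  have h1 : HasDerivAt (fun v : ℂ => -x * v + 1 / v) (-x - v⁻¹ ^ 2) v := by
    simpa [sub_eq_add_neg] using ((hasDerivAt_id v).const_mul (-x)).fun_add (hasDerivAt_inv hv)
  refine (h1.cexp.mul (hasDerivAt_zpow α v (Or.inl hv))).congr_deriv ?_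
  rw [besselOuter, zpow_sub_one₀ hv]
  ring

theorem hasDerivAt_besselInner (α : ℤ) (y : ℂ) {u : ℂ} (hu : u ≠ 0) :
    HasDerivAt (besselInner α y) ((y + u⁻¹ ^ 2 - α * u⁻¹) * besselInner α y u) u := by
  have h1 : HasDerivAt (fun u : ℂ => y * u - 1 / u) (y + u⁻¹ ^ 2) u := by
    simpa using ((hasDerivAt_id u).const_mul y).fun_sub (hasDerivAt_inv hu)
  refine (h1.cexp.mul (hasDerivAt_zpow (-α) u (Or.inl hu))).congr_deriv ?_
  rw [besselInner, zpow_sub_one₀ hu]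
  push_cast
  ring

theorem differentiableOn_besselOuter (α : ℤ) (x : ℂ) :
    DifferentiableOn ℂ (besselOuter α x) {0}ᶜ := fun _ hv =>
  (hasDerivAt_besselOuter α x hv).differentiableAt.differentiableWithinAt

theorem differentiableOn_besselInner (α : ℤ) (y : ℂ) :
    DifferentiableOn ℂ (besselInner α y) {0}ᶜ := fun _ hu =>
  (hasDerivAt_besselInner α y hu).differentiableAt.differentiableWithinAt

theorem exists_besselInner_eq (α : ℤ) (y : ℂ) : ∃ g P : ℂ → ℂ, Differentiable ℂ g ∧
    Differentiable ℂ P ∧ P 0 = 0 ∧ ∀ u, u ≠ 0 → besselInner α y u = g u + P u⁻¹ := by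
  obtain ⟨g, P, hg, hP, hP0, h⟩ := exists_principalPart isOpen_univ (mem_univ (0 : ℂ))
    (f := besselInner α y) (by simpa [compl_eq_univ_sdiff] using differentiableOn_besselInner α y)
  exact ⟨g, P, differentiableOn_univ.1 hg, hP, hP0, fun u hu => by
    simpa using h u (mem_univ u) hu⟩

theorem besselIntegrand_eq (α : ℤ) (x y : ℂ) {u v : ℂ} :
    exp (-x * v + y * u) / (u - v) * exp (-1 / u + 1 / v) * (v / u) ^ α =
      besselOuter α x v * (besselInner α y u / (u - v)) := by
  have h : exp (-x * v + y * u) * exp (-1 / u + 1 / v) =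
      exp (-x * v + 1 / v) * exp (y * u - 1 / u) := by
    rw [← exp_add, ← exp_add]
    ring_nf
  rw [besselOuter, besselInner, div_zpow, zpow_neg, div_mul_eq_mul_div, h]
  ring

namespace ClosedContour

variable {Γout Γin : ClosedContour}

theorem Encloses.encircles (h : Γout.Encloses Γin) {a : ℂ} (ha : Γin.Encircles a) :
    Γout.Encircles a := h a (Or.inr (by rw [ha.2]; exact one_ne_zero))

theorem Encloses.notMem_trace (h : Γout.Encloses Γin) {v : ℂ} (hv : v ∈ Γout.trace) :
    v ∉ Γin.trace := fun hv' => (h v (Or.inl hv')).1 hv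

/-- A non-zero winding number would make `Γout` encircle a point of its own trace. -/
theorem Encloses.windingNumber_eq_zero (h : Γout.Encloses Γin) {v : ℂ} (hv : v ∈ Γout.trace) :
    Γin.windingNumber v = 0 := by
  by_contra h'
  exact (h v (Or.inr h')).1 hv

theorem Encircles.ne_of_mem_trace {Γ : ClosedContour} {a z : ℂ} (h : Γ.Encircles a)
    (hz : z ∈ Γ.trace) : z ≠ a := fun hza => h.1 (hza ▸ hz)

end ClosedContour

open ClosedContour

/-- The right side no longer involves `Γin`, and its integrand is singular only at `0`; contour
independence and integration by parts both start here. -/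
theorem besselKernel_eq_integral {α : ℤ} {y : ℂ} {g P : ℂ → ℂ} (hg : Differentiable ℂ g)
    (hP : Differentiable ℂ P) (hP0 : P 0 = 0)
    (hgP : ∀ u, u ≠ 0 → besselInner α y u = g u + P u⁻¹) {Γout Γin : ClosedContour}
    (h0 : Γin.Encircles 0) (henc : Γout.Encloses Γin) (x : ℂ) :
    besselKernel α Γout Γin x y = Γout.integral fun v => besselOuter α x v * -P v⁻¹ := by
  refine integral_congr fun v hv => ?_
  simp only [besselIntegrand_eq, integral_const_mul]
  rw [integral_div_sub_eq_neg_principalPart hg hP hP0 hgP h0 (henc.notMem_trace hv)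
    (henc.windingNumber_eq_zero hv)]

theorem differentiableOn_besselOuter_mul {α : ℤ} (x : ℂ) {P : ℂ → ℂ} (hP : Differentiable ℂ P) :
    DifferentiableOn ℂ (fun v => besselOuter α x v * -P v⁻¹) {0}ᶜ :=
  (differentiableOn_besselOuter α x).mul
    (hP.comp_differentiableOn (differentiableOn_inv.mono fun _ h => h)).neg

/-- The Bessel kernel does not depend on the contours. -/
theorem besselKernel_eq_besselKernel (α : ℤ) {Γout Γin Γout' Γin' : ClosedContour}
    (h0 : Γin.Encircles 0) (henc : Γout.Encloses Γin) (h0' : Γin'.Encircles 0)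
    (henc' : Γout'.Encloses Γin') (x y : ℂ) :
    besselKernel α Γout Γin x y = besselKernel α Γout' Γin' x y := by
  obtain ⟨g, P, hg, hP, hP0, hgP⟩ := exists_besselInner_eq α y
  rw [besselKernel_eq_integral hg hP hP0 hgP h0 henc,
    besselKernel_eq_integral hg hP hP0 hgP h0' henc']
  exact integral_eq_of_encircles (S := {0}) (by simpa using differentiableOn_besselOuter_mul x hP)
    (by simpa using henc.encircles h0) (by simpa using henc'.encircles h0')

/-- Integration by parts in the double integral of the Bessel kernel. -/
theorem sub_mul_besselKernel (α : ℤ) {Γout Γin : ClosedContour} (h0 : Γin.Encircles 0)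
    (henc : Γout.Encloses Γin) (x y : ℂ) :
    (x - y) * besselKernel α Γout Γin x y =
      (α * (Γout.integral fun v => besselOuter α x v * v⁻¹) -
          Γout.integral fun v => besselOuter α x v * v⁻¹ ^ 2) *
        (Γin.integral fun u => besselInner α y u * u⁻¹) -
      (Γout.integral fun v => besselOuter α x v * v⁻¹) *
        Γin.integral fun u => besselInner α y u * u⁻¹ ^ 2 := by
  obtain ⟨g, P, hg, hP, hP0, hgP⟩ := exists_besselInner_eq α y
  rw [besselKernel_eq_integral hg hP hP0 hgP h0 henc]
  have h0out := henc.encircles h0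
  have hcin : ContinuousOn (besselInner α y) Γin.trace :=
    (differentiableOn_besselInner α y).continuousOn.mono fun u hu => h0.ne_of_mem_trace hu
  have hiin : ContinuousOn (fun u : ℂ => u⁻¹) Γin.trace :=
    continuousOn_inv₀.mono fun u hu => h0.ne_of_mem_trace hu
  have hcout : ContinuousOn (besselOuter α x) Γout.trace :=
    (differentiableOn_besselOuter α x).continuousOn.mono fun u hu => h0out.ne_of_mem_trace hu
  have hiout : ContinuousOn (fun u : ℂ => u⁻¹) Γout.trace :=
    continuousOn_inv₀.mono fun u hu => h0out.ne_of_mem_trace hu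
  have hcK : ContinuousOn (fun v => besselOuter α x v * -P v⁻¹) Γout.trace :=
    (differentiableOn_besselOuter_mul x hP).continuousOn.mono fun u hu => h0out.ne_of_mem_trace hu
  set b₁ := Γin.integral fun u => besselInner α y u * u⁻¹ with hb₁
  set b₂ := Γin.integral fun u => besselInner α y u * u⁻¹ ^ 2 with hb₂
  -- Chosen so that `P₂(1/u)` is the derivative of `P(1/u)`, hence the principal part of the
  -- derivative of the inner factor.
  let P₂ : ℂ → ℂ := fun s => -s ^ 2 * deriv P s
  have hP₂ : Differentiable ℂ P₂ := by
    have := hP.deriv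
    fun_prop
  have hderiv : ∀ u, u ≠ 0 →
      (y + u⁻¹ ^ 2 - α * u⁻¹) * besselInner α y u = deriv g u + P₂ u⁻¹ := by
    intro u hu
    have h1 := (hg u).hasDerivAt.add ((hP u⁻¹).hasDerivAt.comp u (hasDerivAt_inv hu))
    refine ((hasDerivAt_besselInner α y hu).unique (h1.congr_of_eventuallyEq ?_)).trans ?_
    · filter_upwards [isOpen_ne.mem_nhds hu] with w hw using hgP w hw
    · simp only [P₂]
      ring
  -- The Cauchy integral of the derivative of the inner factor is computed by replacing powers of
  -- `1/u` by powers of `1/v`; the errors are divisible by `u - v` and leave only the moments `b₁`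
  -- and `b₂`.
  have hinner : ∀ v ∈ Γout.trace, -P₂ v⁻¹ =
      (y + v⁻¹ ^ 2 - α * v⁻¹) * -P v⁻¹ + (α * v⁻¹ - v⁻¹ ^ 2) * b₁ - v⁻¹ * b₂ := by
    intro v hv
    have hv1 := henc.notMem_trace hv
    have hv2 := henc.windingNumber_eq_zero hv
    have hv0 : v ≠ 0 := h0out.ne_of_mem_trace hv
    rw [← integral_div_sub_eq_neg_principalPart hg.deriv hP₂ (by simp [P₂]) hderiv h0 hv1 hv2,
      ← integral_div_sub_eq_neg_principalPart hg hP hP0 hgP h0 hv1 hv2, hb₁, hb₂,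
      ← integral_const_mul, ← integral_const_mul, ← integral_const_mul]
    have hiv : ContinuousOn (fun u => besselInner α y u / (u - v)) Γin.trace :=
      hcin.div (by fun_prop) fun u hu h => hv1 (sub_eq_zero.1 h ▸ hu)
    have c1 : ContinuousOn (fun u => (y + v⁻¹ ^ 2 - α * v⁻¹) * (besselInner α y u / (u - v)))
      Γin.trace := continuousOn_const.mul hiv
    have c2 : ContinuousOn (fun u => (α * v⁻¹ - v⁻¹ ^ 2) * (besselInner α y u * u⁻¹)) Γin.trace :=
      continuousOn_const.mul (hcin.mul hiin)
    have c3 : ContinuousOn (fun u => v⁻¹ * (besselInner α y u * u⁻¹ ^ 2)) Γin.trace :=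
      continuousOn_const.mul (hcin.mul (hiin.pow 2))
    rw [← integral_add c1 c2, ← integral_sub (c1.fun_add c2) c3]
    refine integral_congr fun u hu => ?_
    have hu0 : u ≠ 0 := h0.ne_of_mem_trace hu
    have huv : u - v ≠ 0 := fun h => hv1 (sub_eq_zero.1 h ▸ hu)
    field_simp
    ring
  -- The integrand is the derivative of `besselOuter α x v * -P v⁻¹`: the terms in `v⁻¹` and `v⁻¹ ^
  -- 2` multiplying `-P v⁻¹` cancel between the two factors, leaving `y - x`.
  have hzero : (Γout.integral fun v => (y - x) * (besselOuter α x v * -P v⁻¹) +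
      besselOuter α x v * v⁻¹ * (α * b₁ - b₂) - besselOuter α x v * v⁻¹ ^ 2 * b₁) = 0 := by
    refine integral_eq_zero_of_hasDerivAt (F := fun v => besselOuter α x v * -P v⁻¹)
      (fun v hv => ?_) (((continuousOn_const.mul hcK).add
        ((hcout.mul hiout).mul continuousOn_const)).sub
        ((hcout.mul (hiout.pow 2)).mul continuousOn_const))
    have hv0 : v ≠ 0 := h0out.ne_of_mem_trace hv
    have h1 := (hasDerivAt_besselOuter α x hv0).mul
      ((hP v⁻¹).hasDerivAt.comp v (hasDerivAt_inv hv0)).neg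
    refine h1.congr_deriv ?_
    have h2 := hinner v hv
    simp only [P₂] at h2
    have h3 : (v ^ 2)⁻¹ = v⁻¹ ^ 2 := (inv_pow v 2).symm
    simp only [h3, Pi.neg_apply, Function.comp_apply]
    linear_combination besselOuter α x v * h2
  have c1 : ContinuousOn (fun v => (y - x) * (besselOuter α x v * -P v⁻¹)) Γout.trace :=
    continuousOn_const.mul hcK
  have c2 : ContinuousOn (fun v => besselOuter α x v * v⁻¹ * (α * b₁ - b₂)) Γout.trace :=
    (hcout.mul hiout).mul continuousOn_const
  have c3 : ContinuousOn (fun v => besselOuter α x v * v⁻¹ ^ 2 * b₁) Γout.trace :=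
    (hcout.mul (hiout.pow 2)).mul continuousOn_const
  rw [integral_sub (f := fun v => (y - x) * (besselOuter α x v * -P v⁻¹) +
      besselOuter α x v * v⁻¹ * (α * b₁ - b₂)) (c1.add c2) c3, integral_add c1 c2,
    integral_const_mul, integral_mul_const, integral_mul_const] at hzero
  linear_combination -hzero

/-! ### Telescoping products and finite-rank kernels -/

/-- Telescoping expansion of a product of quotients whose numerators and denominators differ by a
constant. -/
theorem prod_div_eq_one_add_sum {n : ℕ} {a b : Fin n → ℂ} {d : ℂ} (hb : ∀ i, b i ≠ 0)
    (hab : ∀ i, a i = b i + d) :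
    ∏ i, a i / b i =
      1 + ∑ i, d * ((∏ j ∈ Finset.Iio i, a j) / ∏ j ∈ Finset.Iic i, b j) := by
  have hbs : ∀ s : Finset (Fin n), ∏ j ∈ s, b j ≠ 0 := fun s =>
    Finset.prod_ne_zero_iff.2 fun i _ => hb i
  have h := Finset.prod_add_ordered Finset.univ b fun _ => d
  -- The ordered expansion of `∏ (b i + d)` sorts terms by the last index at which `d` is chosen:
  -- factors before it are `a j`, factors after it are `b j`.
  simp only [← hab] at h
  rw [Finset.prod_div_distrib, h, add_div, div_self (hbs _), Finset.sum_div]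
  congr 1
  refine Finset.sum_congr rfl fun i _ => ?_
  have hsplit : ∏ j, b j = (∏ j ∈ Finset.Iic i, b j) * ∏ j with i < j, b j := by
    rw [← Finset.prod_filter_mul_prod_filter_not Finset.univ (fun j => j ≤ i)]
    congr 2 <;> ext j <;> simp
  have hIio : (Finset.univ.filter fun j => j < i) = Finset.Iio i := by
    ext j
    simp
  rw [hsplit, hIio]
  have h1 := hbs (Finset.Iic i)
  have h2 := hbs (Finset.univ.filter fun j => i < j)
  field_simp

section FiniteRank

/-- Kernels that are finite sums of products of a function of `x` and a function of `y`. -/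
def IsFiniteRankKernel (K : ℂ → ℂ → ℂ) : Prop :=
  ∃ (L : ℕ) (F G : Fin L → ℂ → ℂ), ∀ x y : ℂ, K x y = ∑ l, F l x * G l y

theorem IsFiniteRankKernel.mul (F G : ℂ → ℂ) : IsFiniteRankKernel fun x y => F x * G y :=
  ⟨1, fun _ => F, fun _ => G, by simp⟩

theorem IsFiniteRankKernel.add {K₁ K₂ : ℂ → ℂ → ℂ} (h₁ : IsFiniteRankKernel K₁)
    (h₂ : IsFiniteRankKernel K₂) : IsFiniteRankKernel fun x y => K₁ x y + K₂ x y := by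
  obtain ⟨L₁, F₁, G₁, h₁⟩ := h₁
  obtain ⟨L₂, F₂, G₂, h₂⟩ := h₂
  refine ⟨L₁ + L₂, Fin.append F₁ F₂, Fin.append G₁ G₂, fun x y => ?_⟩
  simp [Fin.sum_univ_add, h₁, h₂]

theorem IsFiniteRankKernel.sum {ι : Type*} (s : Finset ι) {K : ι → ℂ → ℂ → ℂ}
    (h : ∀ i, IsFiniteRankKernel (K i)) : IsFiniteRankKernel fun x y => ∑ i ∈ s, K i x y := by
  classical
  induction s using Finset.induction_on with
  | empty => exact ⟨0, fun _ => 0, fun _ => 0, by simp⟩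
  | insert a s ha ih => simpa [Finset.sum_insert ha] using (h a).add ih

theorem IsFiniteRankKernel.neg {K : ℂ → ℂ → ℂ} (h : IsFiniteRankKernel K) :
    IsFiniteRankKernel fun x y => -K x y := by
  obtain ⟨L, F, G, h⟩ := h
  exact ⟨L, fun l x => -F l x, G, fun x y => by simp [h]⟩

theorem IsFiniteRankKernel.sub_mul_mul (F G : ℂ → ℂ) :
    IsFiniteRankKernel fun x y => (x - y) * (F x * G y) := by
  convert (IsFiniteRankKernel.mul (fun x => x * F x) G).add
    (IsFiniteRankKernel.mul F fun y => -y * G y) using 3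
  ring

/-- The diagonal condition is automatic: at `y = x` the finite-rank expression equals `(x - x) * K x
x = 0`. -/
theorem IsFiniteRankKernel.isIIKSIntegrable {K : ℂ → ℂ → ℂ}
    (h : IsFiniteRankKernel fun x y => (x - y) * K x y) : IsIIKSIntegrable K := by
  obtain ⟨L, F, G, h⟩ := h
  refine ⟨L, F, G, fun x y hxy => ?_, fun x => by simp [← h]⟩
  rw [← Finset.sum_div, ← h, mul_div_cancel_left₀ _ (sub_ne_zero.2 hxy)]

theorem isFiniteRankKernel_sub_mul_besselKernel (α : ℤ) {Γout Γin : ClosedContour}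
    (h0 : Γin.Encircles 0) (henc : Γout.Encloses Γin) :
    IsFiniteRankKernel fun x y => (x - y) * besselKernel α Γout Γin x y := by
  simp only [sub_mul_besselKernel α h0 henc]
  simp only [sub_eq_add_neg (_ * _)]
  exact (IsFiniteRankKernel.mul _ _).add (IsFiniteRankKernel.mul _ _).neg

end FiniteRank

/-! ### The finite-rank perturbation -/

section Perturbation

variable {n m : ℕ} (ν : ℤ) (π : Fin n → ℂ) (θ : Fin m → ℂ)

theorem tildeLambda_eq {Γ Γ' : ClosedContour} (h : Γ.Encircles 0) (h' : Γ'.Encircles 0)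
    (i : Fin m) (x : ℂ) : tildeLambda ν n θ Γ i x = tildeLambda ν n θ Γ' i x := by
  refine integral_eq_of_encircles (S := {0}) ?_ (by simpa using h) (by simpa using h')
  rw [Finset.coe_singleton]
  exact (differentiableOn_besselOuter (ν + n - m) x).mul (by fun_prop)

theorem capLambda_eq {Γ Γ' : ClosedContour} (h : Γ.Encircles 0 ∧ ∀ l, Γ.Encircles (π l))
    (h' : Γ'.Encircles 0 ∧ ∀ l, Γ'.Encircles (π l)) (j : Fin n) (x : ℂ) :
    capLambda ν π θ Γ j x = capLambda ν π θ Γ' j x := by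
  refine integral_eq_of_encircles (S := insert 0 (Finset.univ.image π)) ?_ (by simpa using h)
    (by simpa using h')
  refine ((differentiableOn_besselOuter (ν + n - m) x).mono fun v hv => ?_).mul
    (DifferentiableOn.div (by fun_prop) (by fun_prop) fun v hv => ?_)
  · simp only [Finset.coe_insert, mem_compl_iff, mem_insert_iff, not_or] at hv
    exact hv.1
  · refine Finset.prod_ne_zero_iff.2 fun l _ hl => hv ?_
    simp [sub_eq_zero.1 hl]

theorem tildeXi_eq {Γ Γ' : ClosedContour} (h : Γ.Encircles 0 ∧ ∀ k, Γ.Encircles (θ k))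
    (h' : Γ'.Encircles 0 ∧ ∀ k, Γ'.Encircles (θ k)) (i : Fin m) (y : ℂ) :
    tildeXi ν n θ Γ i y = tildeXi ν n θ Γ' i y := by
  refine integral_eq_of_encircles (S := insert 0 (Finset.univ.image θ)) ?_ (by simpa using h)
    (by simpa using h')
  have hexp : -ν - n + m = -(ν + n - m) := by ring
  rw [hexp]
  refine ((differentiableOn_besselInner (ν + n - m) y).mono fun v hv => ?_).mul
    (DifferentiableOn.fun_finsetProd fun k _ => DifferentiableOn.div (by fun_prop) (by fun_prop)
      fun u hu hk => hu ?_)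
  · simp only [Finset.coe_insert, mem_compl_iff, mem_insert_iff, not_or] at hv
    exact hv.1
  · simp [sub_eq_zero.1 hk]

theorem capXi_eq {Γ Γ' : ClosedContour} (h : Γ.Encircles 0 ∧ ∀ k, Γ.Encircles (θ k))
    (h' : Γ'.Encircles 0 ∧ ∀ k, Γ'.Encircles (θ k)) (j : Fin n) (y : ℂ) :
    capXi ν π θ Γ j y = capXi ν π θ Γ' j y := by
  refine integral_eq_of_encircles (S := insert 0 (Finset.univ.image θ)) ?_ (by simpa using h)
    (by simpa using h')
  have hexp : -ν - n + m = -(ν + n - m) := by ring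
  rw [hexp]
  refine ((differentiableOn_besselInner (ν + n - m) y).mono fun v hv => ?_).mul
    (DifferentiableOn.div (by fun_prop) (by fun_prop) fun u hu => ?_)
  · simp only [Finset.coe_insert, mem_compl_iff, mem_insert_iff, not_or] at hv
    exact hv.1
  · refine Finset.prod_ne_zero_iff.2 fun l _ hl => hu ?_
    simp [sub_eq_zero.1 hl]

variable {ν π θ}

/-- Expand the `π`-product first, with `d = u - v`, keeping the full `θ`-quotient on its correction
terms; then expand the remaining `θ`-quotient with `d = v - u`. This order explains the opposite
signs and why the full `θ`-product appears only in the `π`-terms. -/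
theorem perturbedIntegrand_eq (x y : ℂ) {u v : ℂ} (huv : u ≠ v) (hv : ∀ l, v ≠ π l)
    (hu : ∀ k, u ≠ θ k) :
    exp (-x * v + y * u) / (u - v) * exp (-1 / u + 1 / v) * (v / u) ^ (ν + n - m) *
        (∏ l, (u - π l) / (v - π l)) * ∏ k, (v - θ k) / (u - θ k) =
      besselOuter (ν + n - m) x v * (besselInner (ν + n - m) y u / (u - v)) -
        ∑ i, (besselOuter (ν + n - m) x v * ∏ k ∈ Finset.Iio i, (v - θ k)) *
          (besselInner (ν + n - m) y u * ∏ k ∈ Finset.Iic i, 1 / (u - θ k)) +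
        ∑ j, (besselOuter (ν + n - m) x v *
            ((∏ k, (v - θ k)) / ∏ l ∈ Finset.Iic j, (v - π l))) *
          (besselInner (ν + n - m) y u *
            ((∏ l ∈ Finset.Iio j, (u - π l)) / ∏ k, (u - θ k))) := by
  rw [besselIntegrand_eq]
  generalize besselOuter (ν + n - m) x v = A
  generalize besselInner (ν + n - m) y u = B
  have hd : u - v ≠ 0 := sub_ne_zero.2 huv
  have hπ := prod_div_eq_one_add_sum (a := fun l => u - π l) (b := fun l => v - π l) (d := u - v)
    (fun l => sub_ne_zero.2 (hv l)) fun l => by ring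
  have hθ := prod_div_eq_one_add_sum (a := fun k => v - θ k) (b := fun k => u - θ k) (d := v - u)
    (fun k => sub_ne_zero.2 (hu k)) fun k => by ring
  have e1 : ∑ i, (A * ∏ k ∈ Finset.Iio i, (v - θ k)) * (B * ∏ k ∈ Finset.Iic i, 1 / (u - θ k)) =
      A * B * ∑ i, (∏ k ∈ Finset.Iio i, (v - θ k)) / ∏ k ∈ Finset.Iic i, (u - θ k) := by
    rw [Finset.mul_sum]
    refine Finset.sum_congr rfl fun i _ => ?_
    simp only [one_div, Finset.prod_inv_distrib]
    ring
  have e2 : ∑ j, (A * ((∏ k, (v - θ k)) / ∏ l ∈ Finset.Iic j, (v - π l))) *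
        (B * ((∏ l ∈ Finset.Iio j, (u - π l)) / ∏ k, (u - θ k))) =
      A * B * (∏ k, (v - θ k) / (u - θ k)) *
        ∑ j, (∏ l ∈ Finset.Iio j, (u - π l)) / ∏ l ∈ Finset.Iic j, (v - π l) := by
    rw [Finset.mul_sum, Finset.prod_div_distrib]
    refine Finset.sum_congr rfl fun j _ => ?_
    ring
  rw [e1, e2, hπ]
  rw [← Finset.mul_sum] at hθ ⊢
  generalize ∑ j, (∏ l ∈ Finset.Iio j, (u - π l)) / ∏ l ∈ Finset.Iic j, (v - π l) = Sπ
  generalize ∑ i, (∏ k ∈ Finset.Iio i, (v - θ k)) / ∏ k ∈ Finset.Iic i, (u - θ k) = Sθ at hθ ⊢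
  rw [hθ]
  field_simp
  ring

/-- The decomposition on the given contours, by integrating the pointwise identity first in `u`,
then in `v`; other contours enter only through contour independence. -/
theorem perturbedBesselKernel_eq {Γout Γin : ClosedContour}
    (hΓ : AdmissibleContours π θ Γout Γin) (x y : ℂ) :
    perturbedBesselKernel ν π θ Γout Γin x y =
      besselKernel (ν + n - m) Γout Γin x y
        - ∑ i, tildeLambda ν n θ Γout i x * tildeXi ν n θ Γin i y
        + ∑ j, capLambda ν π θ Γout j x * capXi ν π θ Γin j y := by
  obtain ⟨h0, hθ, hπ, henc⟩ := hΓ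
  obtain ⟨g, P, hg, hP, hP0, hgP⟩ := exists_besselInner_eq (ν + n - m) y
  have h0out := henc.encircles h0
  have hexp : -ν - n + m = -(ν + n - m) := by ring
  have hu0 : Γin.trace ⊆ {0}ᶜ := fun u hu => h0.ne_of_mem_trace hu
  have hv0 : Γout.trace ⊆ {0}ᶜ := fun u hu => h0out.ne_of_mem_trace hu
  have hcB : ContinuousOn (besselInner (ν + n - m) y) Γin.trace :=
    (differentiableOn_besselInner _ y).continuousOn.mono hu0
  have hcA : ContinuousOn (besselOuter (ν + n - m) x) Γout.trace :=
    (differentiableOn_besselOuter _ x).continuousOn.mono hv0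
  have hcK : ContinuousOn (fun v => besselOuter (ν + n - m) x v * -P v⁻¹) Γout.trace :=
    (differentiableOn_besselOuter_mul x hP).continuousOn.mono hv0
  have hcX₁ : ∀ i : Fin m, ContinuousOn (fun u => besselInner (ν + n - m) y u *
      ∏ k ∈ Finset.Iic i, 1 / (u - θ k)) Γin.trace := fun i =>
    hcB.mul (continuousOn_finsetProd _ fun k _ => continuousOn_const.div (by fun_prop)
      fun u hu => sub_ne_zero.2 ((hθ k).ne_of_mem_trace hu))
  have hcX₂ : ∀ j : Fin n, ContinuousOn (fun u => besselInner (ν + n - m) y u *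
      ((∏ l ∈ Finset.Iio j, (u - π l)) / ∏ k, (u - θ k))) Γin.trace := fun j =>
    hcB.mul (ContinuousOn.div (by fun_prop) (by fun_prop) fun u hu =>
      Finset.prod_ne_zero_iff.2 fun k _ => sub_ne_zero.2 ((hθ k).ne_of_mem_trace hu))
  have hcL₁ : ∀ i : Fin m, ContinuousOn (fun v => besselOuter (ν + n - m) x v *
      ∏ k ∈ Finset.Iio i, (v - θ k)) Γout.trace := fun i => hcA.mul (by fun_prop)
  have hcL₂ : ∀ j : Fin n, ContinuousOn (fun v => besselOuter (ν + n - m) x v *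
      ((∏ k, (v - θ k)) / ∏ l ∈ Finset.Iic j, (v - π l))) Γout.trace := fun j =>
    hcA.mul (ContinuousOn.div (by fun_prop) (by fun_prop) fun v hv =>
      Finset.prod_ne_zero_iff.2 fun l _ => sub_ne_zero.2 ((hπ l).ne_of_mem_trace hv))
  have hX₁ : ∀ i : Fin m, (Γin.integral fun u => besselInner (ν + n - m) y u *
      ∏ k ∈ Finset.Iic i, 1 / (u - θ k)) = tildeXi ν n θ Γin i y := fun i => by
    simp only [tildeXi, hexp, besselInner]
  have hX₂ : ∀ j : Fin n, (Γin.integral fun u => besselInner (ν + n - m) y u *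
      ((∏ l ∈ Finset.Iio j, (u - π l)) / ∏ k, (u - θ k))) = capXi ν π θ Γin j y := fun j => by
    simp only [capXi, hexp, besselInner]
  have hinner : ∀ v ∈ Γout.trace,
      (Γin.integral fun u => exp (-x * v + y * u) / (u - v) * exp (-1 / u + 1 / v) *
        (v / u) ^ (ν + n - m) * (∏ l, (u - π l) / (v - π l)) * ∏ k, (v - θ k) / (u - θ k)) =
      besselOuter (ν + n - m) x v * -P v⁻¹ -
        ∑ i, (besselOuter (ν + n - m) x v * ∏ k ∈ Finset.Iio i, (v - θ k)) *
          tildeXi ν n θ Γin i y +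
        ∑ j, (besselOuter (ν + n - m) x v *
            ((∏ k, (v - θ k)) / ∏ l ∈ Finset.Iic j, (v - π l))) * capXi ν π θ Γin j y := by
    intro v hv
    have hvΓ := henc.notMem_trace hv
    have hne : ∀ u ∈ Γin.trace, u ≠ v := fun u hu h => hvΓ (h ▸ hu)
    rw [integral_congr fun u hu => perturbedIntegrand_eq x y (hne u hu)
      (fun l => (hπ l).ne_of_mem_trace hv) fun k => (hθ k).ne_of_mem_trace hu]
    have c1 : ContinuousOn (fun u => besselOuter (ν + n - m) x v *
        (besselInner (ν + n - m) y u / (u - v))) Γin.trace :=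
      continuousOn_const.mul (hcB.div (by fun_prop) fun u hu => sub_ne_zero.2 (hne u hu))
    have c2 := fun i : Fin m => (continuousOn_const (s := Γin.trace)
      (c := besselOuter (ν + n - m) x v * ∏ k ∈ Finset.Iio i, (v - θ k))).fun_mul (hcX₁ i)
    have c3 := fun j : Fin n => (continuousOn_const (s := Γin.trace)
      (c := besselOuter (ν + n - m) x v *
        ((∏ k, (v - θ k)) / ∏ l ∈ Finset.Iic j, (v - π l)))).fun_mul (hcX₂ j)
    have s2 := continuousOn_finsetSum Finset.univ fun i _ => c2 i
    have s3 := continuousOn_finsetSum Finset.univ fun j _ => c3 j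
    rw [integral_add (c1.fun_sub s2) s3, integral_sub c1 s2, integral_sum _ fun i _ => c2 i,
      integral_sum _ fun j _ => c3 j]
    simp only [integral_const_mul, hX₁, hX₂]
    rw [integral_div_sub_eq_neg_principalPart hg hP hP0 hgP h0 hvΓ (henc.windingNumber_eq_zero hv)]
  rw [besselKernel_eq_integral hg hP hP0 hgP h0 henc]
  have d2 := fun i : Fin m => (hcL₁ i).fun_mul (continuousOn_const (s := Γout.trace)
    (c := tildeXi ν n θ Γin i y))
  have d3 := fun j : Fin n => (hcL₂ j).fun_mul (continuousOn_const (s := Γout.trace)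
    (c := capXi ν π θ Γin j y))
  have s2 := continuousOn_finsetSum Finset.univ fun i _ => d2 i
  have s3 := continuousOn_finsetSum Finset.univ fun j _ => d3 j
  rw [perturbedBesselKernel, integral_congr hinner, integral_add (hcK.fun_sub s2) s3,
    integral_sub hcK s2, integral_sum _ fun i _ => d2 i, integral_sum _ fun j _ => d3 j]
  simp only [integral_mul_const, tildeLambda, capLambda, besselOuter]

end Perturbation

theorem mainTheorem12 (n m : ℕ) (ν : ℤ) (π : Fin n → ℂ) (θ : Fin m → ℂ)
    (Γout Γin : ClosedContour) (hΓ : AdmissibleContours π θ Γout Γin) :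
    IsIIKSIntegrable (perturbedBesselKernel ν π θ Γout Γin) ∧
    ∀ Bout Bin Γπ Γθ : ClosedContour,
      Bin.Encircles 0 → Bout.Encloses Bin →
      (Γπ.Encircles 0 ∧ ∀ l, Γπ.Encircles (π l)) →
      (Γθ.Encircles 0 ∧ ∀ k, Γθ.Encircles (θ k)) →
      ∀ x y : ℂ,
        perturbedBesselKernel ν π θ Γout Γin x y =
          besselKernel (ν + n - m) Bout Bin x y
            - ∑ i, tildeLambda ν n θ Γπ i x * tildeXi ν n θ Γθ i y
            + ∑ j, capLambda ν π θ Γπ j x * capXi ν π θ Γθ j y := by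
  have hker := perturbedBesselKernel_eq (ν := ν) hΓ
  obtain ⟨h0, hθ, hπ, henc⟩ := hΓ
  have h0out := henc.encircles h0
  refine ⟨IsFiniteRankKernel.isIIKSIntegrable ?_, fun Bout Bin Γπ Γθ hB0 hB hΓπ hΓθ x y => ?_⟩
  -- Each summand of the decomposition has finite rank after multiplication by `x - y`.
  · simp only [hker, mul_add, mul_sub, Finset.mul_sum]
    simp only [sub_eq_add_neg _ (∑ i, _)]
    exact ((isFiniteRankKernel_sub_mul_besselKernel _ h0 henc).add
      (IsFiniteRankKernel.sum _ fun i => IsFiniteRankKernel.sub_mul_mul _ _).neg).add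
      (IsFiniteRankKernel.sum _ fun j => IsFiniteRankKernel.sub_mul_mul _ _)
  · rw [hker, besselKernel_eq_besselKernel _ h0 henc hB0 hB]
    simp only [tildeLambda_eq ν θ h0out hΓπ.1, capLambda_eq ν π θ ⟨h0out, hπ⟩ hΓπ,
      tildeXi_eq ν θ ⟨h0, hθ⟩ hΓθ, capXi_eq ν π θ ⟨h0, hθ⟩ hΓθ]
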